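/- Let $p>3$ be a prime and let $i^2=-1$. Put $$\pounds_2(x)=\sum_{k=1}^{p-1}\frac{x^k}{k^2},\qquad q_p(2)=\frac{2^{p-1}-1}{p},$$ let $\left(\frac{-1}{p}\right)$ be the Legendre symbol, and let $E_n$ be the Euler numbers, defined by $\frac{2}{e^t+e^{-t}}=\sum_{n\ge 0}E_n\frac{t^n}{n!}$. Then $$\pounds_2(1\pm i)\equiv -\frac{q_p(2)^2}{8}\left(1\pm i\left(\frac{-1}{p}\right)\right)+\frac12\left(\frac{-1}{p}\right)E_{p-3}\pmod p,$$ $$\pounds_2\!\left(\frac{1\pm i}{2}\right)\equiv -\frac{q_p(2)^2}{8}+\frac14\left(\left(\frac{-1}{p}\right)\pm i\right)E_{p-3}\pmod p,$$ where in each formula either all upper or all lower signs are taken. Here $x\equiv y\pmod p$, for $x,y\in\mathbb{Q}(i)$, means that $x-y\in p\,\mathbb{Z}_{(p)}[i]$, that is, $x-y=p\,z/m$ for some $z\in\mathbb{Z}[i]$ and some integer $m$ not divisible by $p$. -/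

import Mathlib

/-- The finite polylogarithm `£_d(x) = ∑_{k=1}^{p-1} x^k / k^d`, as a function on a field `K`
(here used in characteristic zero, so that no denominator vanishes). -/
def finitePolylog {K : Type*} [Field K] (p d : ℕ) (x : K) : K :=
  ∑ k ∈ Finset.Icc 1 (p - 1), x ^ k / (k : K) ^ d

/-- The Fermat quotient `q_p(a) = (a^(p-1) - 1) / p`. -/
def fermatQuotient {K : Type*} [Field K] (p : ℕ) (a : K) : K :=
  (a ^ (p - 1) - 1) / (p : K)

/-- The Euler number `E_n`, defined by `2 / (e^t + e^(-t)) = ∑_{n ≥ 0} E_n t^n / n!`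
as formal power series over `ℚ`, so that `E_0 = 1`, `E_1 = 0`, `E_2 = -1`, `E_4 = 5`. -/
noncomputable def eulerNumber (n : ℕ) : ℚ :=
  (n.factorial : ℚ) *
    PowerSeries.coeff n
      (2 * (PowerSeries.exp ℚ + PowerSeries.evalNegHom (PowerSeries.exp ℚ))⁻¹)

/-- Congruence modulo `p` of elements of `ℚ(i) ⊆ ℂ`: the difference `x - y` lies in `p R`, where
`R` is the ring of the fractions `z / m` with `z` a Gaussian integer and `m` an integer not
divisible by `p`. -/
def GaussianCongr (p : ℕ) (x y : ℂ) : Prop :=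
  ∃ (m : ℤ) (z : GaussianInt), ¬ (p : ℤ) ∣ m ∧ x - y = (p : ℂ) * ((z : ℂ) / (m : ℂ))

/-! Write `L_d` for the finite polylogarithm modulo `p`. Since `X L_{d+1}' = L_d`, derivatives and
boundary values give `L_1(1-X) = L_1(X)` and `L_1^2 = -2 X^p L_2(X) - 2 (1-X^p) L_2(1-X)`
(`polylogPoly.sq_one`). At `X = J` with `J^2 = -1`, where `J^p = εJ` and `ε = (-1)^((p-1)/2)`, the
second identity yields `L_2(1-J)` from `L_1(J)` and `L_2(J)`, because `(1-εJ)(1+εJ) = 2` makes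
`1-εJ` invertible.

`L_2(J)` is `∑ J^k k^(p-3)`, which telescopes through the polynomials generated by `e^(xt) sech t`
and leaves `E_{p-3}`. `L_1(J)` comes from expanding `(1-J)^p (1+J)^p = 2^p` to first order in `p`.
Finally `(1+J)/2` is the inverse of `1-J`, and `L_2(1/x)` is related to `L_2(x)` by `k ↦ p-k`.

All this takes place in the localized Gaussian integers modulo `p`, which need not be a domain, so
cancellation there uses only that 2 is a unit. -/

theorem Finset.sum_Icc_one_eq_sum_range {M : Type*} [AddCommMonoid M] (f : ℕ → M) (n : ℕ) :
    ∑ k ∈ Finset.Icc 1 n, f k = ∑ k ∈ Finset.range n, f (k + 1) := by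
  rw [Finset.range_eq_Ico, Finset.sum_Ico_add' f 0 n 1]
  rfl

/-! ### Functional equations of the finite polylogarithms modulo `p`. -/

open Polynomial in
/-- The finite polylogarithm `∑_{k=1}^{p-1} X^k / k^d` as a polynomial over `ZMod p`. -/
noncomputable def polylogPoly (p d : ℕ) [Fact p.Prime] : Polynomial (ZMod p) :=
  ∑ k ∈ Finset.Icc 1 (p - 1), C (((k : ZMod p)⁻¹) ^ d) * X ^ k

namespace polylogPoly

open Polynomial

variable (p : ℕ) [Fact p.Prime]

theorem cast_ne_zero_of_mem_Icc {k : ℕ} (hk : k ∈ Finset.Icc 1 (p - 1)) : (k : ZMod p) ≠ 0 := by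
  have hp := (Fact.out : p.Prime).two_le
  rw [Finset.mem_Icc] at hk
  rw [Ne, ZMod.natCast_eq_zero_iff]
  intro h
  have := Nat.le_of_dvd (by omega) h
  omega

theorem X_mul_derivative (d : ℕ) :
    X * derivative (polylogPoly p (d + 1)) = polylogPoly p d := by
  rw [polylogPoly, polylogPoly, derivative_sum, Finset.mul_sum]
  refine Finset.sum_congr rfl fun k hk => ?_
  have hk0 := cast_ne_zero_of_mem_Icc p hk
  obtain ⟨j, rfl⟩ : ∃ j, k = j + 1 := ⟨k - 1, by rw [Finset.mem_Icc] at hk; omega⟩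
  have h : C (((j + 1 : ℕ) : ZMod p)⁻¹) * C ((j + 1 : ℕ) : ZMod p) = 1 := by
    rw [← C_mul, inv_mul_cancel₀ hk0, C_1]
  rw [derivative_C_mul_X_pow, pow_succ, C_mul, C_mul, Nat.add_sub_cancel, pow_succ X j]
  linear_combination (C ((((j + 1 : ℕ) : ZMod p)⁻¹) ^ d) * X ^ j * X) * h

theorem X_sub_one_mul_zero : (X - 1) * polylogPoly p 0 = X ^ p - X := by
  have h : polylogPoly p 0 = X * ∑ k ∈ Finset.range (p - 1), X ^ k := by
    rw [polylogPoly, Finset.mul_sum, Finset.sum_Icc_one_eq_sum_range]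
    simp [pow_succ']
  have hp := (Fact.out : p.Prime).two_le
  rw [h, mul_left_comm, mul_comm (X - 1), geom_sum_mul, mul_sub, mul_one, ← pow_succ',
    Nat.sub_add_cancel (by omega)]

theorem natDegree_le (d : ℕ) : (polylogPoly p d).natDegree ≤ p - 1 := by
  refine natDegree_sum_le_of_forall_le _ _ fun k hk => ?_
  exact (natDegree_C_mul_X_pow_le _ _).trans (Finset.mem_Icc.1 hk).2

theorem natDegree_comp_one_sub_X_le (d : ℕ) : ((polylogPoly p d).comp (1 - X)).natDegree ≤ p - 1 := by
  refine natDegree_comp_le.trans ?_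
  have h : (1 - X : (ZMod p)[X]).natDegree ≤ 1 := by compute_degree
  calc _ ≤ (p - 1) * 1 := Nat.mul_le_mul (natDegree_le p d) h
    _ = _ := mul_one _

theorem eval_zero (d : ℕ) : (polylogPoly p d).eval 0 = 0 := by
  rw [polylogPoly, eval_finsetSum]
  refine Finset.sum_eq_zero fun k hk => ?_
  rw [Finset.mem_Icc] at hk
  simp [show k ≠ 0 by omega]

theorem sum_Icc_eq_sum_units (f : ZMod p → ZMod p) (h0 : f 0 = 0) :
    ∑ k ∈ Finset.Icc 1 (p - 1), f k = ∑ x, f x := by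
  have hp := (Fact.out : p.Prime).two_le
  have : ∑ x, f x = ∑ x ∈ Finset.univ.erase (0 : ZMod p), f x := by
    rw [Finset.sum_erase _ h0]
  rw [this]
  refine Finset.sum_nbij' (fun k => (k : ZMod p)) ZMod.val ?_ ?_ ?_ ?_ ?_
  · intro k hk
    simpa using cast_ne_zero_of_mem_Icc p hk
  · intro x hx
    have h1 := ZMod.val_lt x
    have h2 : x.val ≠ 0 := by simpa using hx
    rw [Finset.mem_Icc]
    omega
  · intro k hk
    rw [Finset.mem_Icc] at hk
    exact ZMod.val_cast_of_lt (by omega)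
  · intro x _
    exact ZMod.natCast_zmod_val x
  · intros
    rfl

/-- By Fermat, `k^(-d) = k^(p-1-d)`, and power sums over `ZMod p` with exponent below `p-1` vanish.
-/
theorem eval_one {d : ℕ} (hd : 0 < d) (hdp : d < p - 1) : (polylogPoly p d).eval 1 = 0 := by
  have h1 : (polylogPoly p d).eval 1 = ∑ k ∈ Finset.Icc 1 (p - 1), (k : ZMod p) ^ (p - 1 - d) := by
    rw [polylogPoly, eval_finsetSum]
    refine Finset.sum_congr rfl fun k hk => ?_
    have hk0 := cast_ne_zero_of_mem_Icc p hk
    have := ZMod.pow_card_sub_one_eq_one hk0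
    rw [eval_mul, eval_C, eval_pow, eval_X, one_pow, mul_one, pow_sub₀ _ hk0 hdp.le, this, one_mul,
      inv_pow]
  rw [h1, sum_Icc_eq_sum_units p (fun x => x ^ (p - 1 - d)) (zero_pow (by omega))]
  exact FiniteField.sum_pow_lt_card_sub_one _ _ (by rw [ZMod.card]; omega)

variable {p} in
-- A zero derivative forces `f = g(X^p)`; the degree bound makes `g` affine, and two values then
-- determine it.
theorem eq_zero_of_derivative_eq_zero {f : (ZMod p)[X]} (hf : derivative f = 0)
    (hdeg : f.natDegree < 2 * p) (h0 : f.eval 0 = 0) (h1 : f.eval 1 = 0) : f = 0 := by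
  have hp := (Fact.out : p.Prime).pos
  have he := expand_contract p hf hp.ne'
  set g := contract p f
  rw [← he] at hdeg h0 h1
  rw [natDegree_expand] at hdeg
  rw [expand_eval, zero_pow hp.ne'] at h0
  rw [expand_eval, one_pow] at h1
  have hg : g.natDegree ≤ 1 := by
    have := Nat.lt_of_mul_lt_mul_right hdeg
    omega
  obtain ⟨a, b, hab⟩ := exists_eq_X_add_C_of_natDegree_le_one hg
  rw [hab] at h0 h1
  simp only [eval_add, eval_mul, eval_C, eval_X, mul_zero, zero_add, mul_one] at h0 h1
  rw [h0, add_zero] at h1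
  rw [← he, hab, h0, h1]
  simp

theorem comp_one_sub_X (hp : 3 < p) : (polylogPoly p 1).comp (1 - X) = polylogPoly p 1 := by
  rw [← sub_eq_zero]
  refine eq_zero_of_derivative_eq_zero ?_ ?_ ?_ ?_
  · have h1 := X_mul_derivative p 0
    have h2 := congrArg (fun q => q.comp (1 - X)) h1
    have h3 := X_sub_one_mul_zero p
    have h4 := congrArg (fun q => q.comp (1 - X)) h3
    have h5 : (1 - X : (ZMod p)[X]) ^ p = 1 - X ^ p := by rw [sub_pow_char, one_pow]
    simp only [mul_comp, sub_comp, X_comp, pow_comp, one_comp, zero_add] at h1 h2 h4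
    rw [h5] at h4
    -- `X(X-1)` clears the denominators: `X(X-1) L_1' = X^p - X`, which changes sign under `X ↦
    -- 1-X`, as does the derivative of a composite.
    have hX : (X * (X - 1) : (ZMod p)[X]) ≠ 0 := mul_ne_zero X_ne_zero (X_sub_C_ne_zero 1)
    refine (mul_eq_zero.1 ?_).resolve_left hX
    rw [derivative_sub, derivative_comp]
    simp only [derivative_sub, derivative_one, derivative_X]
    linear_combination X * h2 - (X - 1) * h1 - h3 - h4
  · refine (natDegree_sub_le _ _).trans_lt (max_lt ?_ ?_)
    · have := natDegree_comp_one_sub_X_le p 1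
      omega
    · have := natDegree_le p 1
      omega
  · simp [eval_comp, eval_zero, eval_one p one_pos (by omega : 1 < p - 1)]
  · simp [eval_comp, eval_zero, eval_one p one_pos (by omega : 1 < p - 1)]

theorem sq_one (hp : 3 < p) : polylogPoly p 1 ^ 2 =
    -2 * X ^ p * polylogPoly p 2 - 2 * (1 - X ^ p) * (polylogPoly p 2).comp (1 - X) := by
  rw [← sub_eq_zero]
  refine eq_zero_of_derivative_eq_zero ?_ ?_ ?_ ?_
  · have h1 := X_mul_derivative p 0
    have h2 := X_mul_derivative p 1
    have h3 := congrArg (fun q => q.comp (1 - X)) h2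
    have h4 := X_sub_one_mul_zero p
    have h5 : derivative (X ^ p : (ZMod p)[X]) = 0 := by
      rw [derivative_X_pow, CharP.cast_eq_zero, C_0, zero_mul]
    have h6 := comp_one_sub_X p hp
    simp only [mul_comp, X_comp, zero_add, Nat.reduceAdd] at h1 h2 h3
    rw [h6] at h3
    have hX : (X * (X - 1) : (ZMod p)[X]) ≠ 0 := mul_ne_zero X_ne_zero (X_sub_C_ne_zero 1)
    refine (mul_eq_zero.1 ?_).resolve_left hX
    have h7 : derivative (polylogPoly p 1 ^ 2) =
        2 * polylogPoly p 1 * derivative (polylogPoly p 1) := by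
      rw [pow_two, derivative_mul]
      ring
    simp only [derivative_sub, derivative_mul, derivative_comp, derivative_one, derivative_X, h5,
      h7, derivative_neg, derivative_ofNat]
    linear_combination 2 * polylogPoly p 1 * (X - 1) * h1 + 2 * X ^ p * (X - 1) * h2
      + 2 * (1 - X ^ p) * X * h3 + 2 * polylogPoly p 1 * h4
  · have h1 := natDegree_comp_one_sub_X_le p 2
    have h2 := natDegree_le p 2
    have h3 := natDegree_le p 1
    have h4 : (1 - X ^ p : (ZMod p)[X]).natDegree ≤ p := by compute_degree
    have h5 : (-2 * X ^ p : (ZMod p)[X]).natDegree ≤ p := by compute_degree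
    have h6 : (2 * (1 - X ^ p) : (ZMod p)[X]).natDegree ≤ p :=
      (natDegree_C_mul_le (2 : ZMod p) _).trans h4
    refine (natDegree_sub_le_of_le (natDegree_pow_le_of_le 2 h3)
      (natDegree_sub_le_of_le (natDegree_mul_le_of_le h5 h2)
        (natDegree_mul_le_of_le h6 h1))).trans_lt ?_
    rw [max_self]
    exact max_lt (by omega) (by omega)
  · simp [eval_comp, eval_zero, eval_one p two_pos (by omega : 2 < p - 1)]
  · simp [eval_comp, eval_zero, eval_one p two_pos (by omega : 2 < p - 1),
      eval_one p one_pos (by omega : 1 < p - 1)]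

end polylogPoly

/-! ### Euler numbers and their Appell polynomials. -/

namespace eulerNumber

open PowerSeries

/-- The power series `2 / (e^t + e^(-t))`. -/
noncomputable def sech : PowerSeries ℚ :=
  2 * (PowerSeries.exp ℚ + PowerSeries.evalNegHom (PowerSeries.exp ℚ))⁻¹

theorem sech_mul : sech * (exp ℚ + rescale (-1 : ℚ) (exp ℚ)) = 2 := by
  have h : constantCoeff (exp ℚ + evalNegHom (exp ℚ)) ≠ 0 := by
    rw [map_add, evalNegHom, ← coeff_zero_eq_constantCoeff_apply,
      ← coeff_zero_eq_constantCoeff_apply, coeff_rescale, coeff_exp]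
    norm_num
  rw [sech, mul_assoc, mul_comm _ (exp ℚ + _)]
  exact (congrArg (2 * ·) (PowerSeries.mul_inv_cancel _ h)).trans (mul_one 2)

theorem rescale_neg_one_sech : rescale (-1 : ℚ) sech = sech := by
  have h := sech_mul
  have h' := congrArg (rescale (-1 : ℚ)) h
  have h2 : rescale (-1 : ℚ) (2 : PowerSeries ℚ) = 2 := map_ofNat _ 2
  rw [map_mul, map_add, rescale_rescale, h2] at h'
  norm_num at h'
  have hne : exp ℚ + rescale (-1 : ℚ) (exp ℚ) ≠ 0 := by
    intro h0
    rw [h0, mul_zero] at h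
    have := congrArg constantCoeff h
    rw [map_zero, map_ofNat] at this
    norm_num at this
  refine mul_right_cancel₀ hne ?_
  rw [h, ← h', add_comm]

/-- `P_m(x)`, with exponential generating function `e^(xt) sech t`. -/
noncomputable def appell (m : ℕ) (x : ℚ) : ℚ :=
  (m.factorial : ℚ) * coeff m (sech * rescale x (exp ℚ))

theorem appell_eq_sum (m : ℕ) (x : ℚ) : appell m x =
    ∑ j ∈ Finset.range (m + 1), (m.choose j : ℚ) * eulerNumber j * x ^ (m - j) := by
  rw [appell, coeff_mul, Finset.Nat.sum_antidiagonal_eq_sum_range_succ_mk, Finset.mul_sum]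
  refine Finset.sum_congr rfl fun j hj => ?_
  have hj' : j ≤ m := by rw [Finset.mem_range] at hj; omega
  rw [eulerNumber, ← sech, coeff_rescale, coeff_exp, Nat.cast_choose ℚ hj']
  have := Nat.factorial_ne_zero j
  have := Nat.factorial_ne_zero (m - j)
  simp only [map_div₀, map_one, map_natCast]
  field_simp

theorem appell_add_one_add_appell_sub_one (m : ℕ) (x : ℚ) :
    appell m (x + 1) + appell m (x - 1) = 2 * x ^ m := by
  have h1 := exp_mul_exp_eq_exp_add (A := ℚ) x 1
  have h2 := exp_mul_exp_eq_exp_add (A := ℚ) x (-1)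
  rw [rescale_one, RingHom.id_apply] at h1
  have h : sech * rescale (x + 1) (exp ℚ) + sech * rescale (x - 1) (exp ℚ) =
      C (2 : ℚ) * rescale x (exp ℚ) := by
    rw [sub_eq_add_neg, ← h1, ← h2, map_ofNat]
    linear_combination rescale x (exp ℚ) * sech_mul
  rw [appell, appell, ← mul_add, ← map_add, h, coeff_C_mul, coeff_rescale, coeff_exp]
  have := Nat.factorial_ne_zero m
  simp only [map_div₀, map_one, map_natCast]
  field_simp

theorem appell_neg (m : ℕ) (x : ℚ) : appell m (-x) = (-1) ^ m * appell m x := by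
  have h : sech * rescale (-x) (exp ℚ) = rescale (-1 : ℚ) (sech * rescale x (exp ℚ)) := by
    rw [map_mul, rescale_neg_one_sech, rescale_rescale, mul_neg_one]
  rw [appell, h, coeff_rescale, appell]
  ring

theorem appell_one_of_even {m : ℕ} (hm : Even m) (h0 : m ≠ 0) : appell m 1 = 0 := by
  have h := appell_add_one_add_appell_sub_one m 0
  rw [zero_add, zero_sub, appell_neg, hm.neg_one_pow, zero_pow h0] at h
  linarith

/-- In the recurrence at `x = 0`, terms with `n-j` odd cancel and the others double, so `E_n` is an
integer combination of earlier Euler numbers plus `0^n`. -/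
theorem exists_int (n : ℕ) : ∃ e : ℤ, eulerNumber n = e := by
  induction n using Nat.strong_induction_on with
  | _ n ih =>
  have h := appell_add_one_add_appell_sub_one n 0
  rw [zero_add, zero_sub, appell_eq_sum, appell_eq_sum, ← Finset.sum_add_distrib,
    Finset.sum_range_succ] at h
  choose! e he using ih
  have h2 : ∀ j ∈ Finset.range n, ∃ c : ℤ, (n.choose j : ℚ) * eulerNumber j * 1 ^ (n - j) +
      (n.choose j : ℚ) * eulerNumber j * (-1) ^ (n - j) = 2 * c := by
    intro j hj
    rw [he j (Finset.mem_range.1 hj)]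
    rcases Nat.even_or_odd (n - j) with h | h
    · refine ⟨n.choose j * e j, ?_⟩
      rw [h.neg_one_pow]
      push_cast
      ring
    · refine ⟨0, ?_⟩
      rw [h.neg_one_pow]
      push_cast
      ring
  choose! c hc using h2
  rw [Finset.sum_congr rfl hc, ← Finset.mul_sum, Nat.choose_self, Nat.sub_self] at h
  refine ⟨0 ^ n - ∑ j ∈ Finset.range n, c j, ?_⟩
  push_cast
  linear_combination h / 2

/-- The integer equal to the Euler number. -/
noncomputable def toInt (n : ℕ) : ℤ := (exists_int n).choose

theorem toInt_spec (n : ℕ) : eulerNumber n = toInt n := (exists_int n).choose_spec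

/-- The polynomial over `ℤ` underlying `appell`. -/
noncomputable def appellPoly (m : ℕ) : Polynomial ℤ :=
  ∑ j ∈ Finset.range (m + 1),
    Polynomial.C ((m.choose j : ℤ) * toInt j) * Polynomial.X ^ (m - j)

theorem appellPoly_eval (m : ℕ) (x : ℤ) : (((appellPoly m).eval x : ℤ) : ℚ) = appell m x := by
  rw [appell_eq_sum, appellPoly, Polynomial.eval_finsetSum]
  push_cast
  refine Finset.sum_congr rfl fun j _ => ?_
  simp [toInt_spec]

theorem appellPoly_rec (m : ℕ) (x : ℤ) :
    (appellPoly m).eval (x + 1) + (appellPoly m).eval (x - 1) = 2 * x ^ m := by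
  have h := appell_add_one_add_appell_sub_one m x
  have h1 := appellPoly_eval m (x + 1)
  have h2 := appellPoly_eval m (x - 1)
  push_cast at h1 h2
  rw [← h1, ← h2] at h
  exact_mod_cast h

theorem appellPoly_one {m : ℕ} (hm : Even m) (h0 : m ≠ 0) : (appellPoly m).eval 1 = 0 := by
  have h := appellPoly_eval m 1
  rw [Int.cast_one, appell_one_of_even hm h0] at h
  exact_mod_cast h

theorem appellPoly_neg_one {m : ℕ} (hm : Even m) (h0 : m ≠ 0) : (appellPoly m).eval (-1) = 0 := by
  have h := appellPoly_rec m 0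
  rw [zero_add, zero_sub, appellPoly_one hm h0, zero_pow h0] at h
  linarith

theorem appellPoly_zero (m : ℕ) : (appellPoly m).eval 0 = toInt m := by
  rw [appellPoly, Polynomial.eval_finsetSum, Finset.sum_range_succ, Finset.sum_eq_zero]
  · simp
  · intro j hj
    rw [Finset.mem_range] at hj
    simp [show m - j ≠ 0 by omega]

/-- In a ring where `J ^ 2 = -1`, the sum `2 ∑ J^k k^m` telescopes. -/
theorem two_mul_sum {F : Type*} [CommRing F] {J : F} (hJ : J ^ 2 = -1) (m n : ℕ) :
    2 * ∑ k ∈ Finset.range n, J ^ (k + 1) * ((k + 1 : ℕ) : F) ^ m =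
      J ^ n * ((appellPoly m).eval (n + 1 : ℤ) : ℤ)
        - J * J ^ n * ((appellPoly m).eval (n : ℤ) : ℤ)
        - ((appellPoly m).eval 1 : ℤ) + J * ((appellPoly m).eval 0 : ℤ) := by
  induction n with
  | zero => simp
  | succ n ih =>
    have h := congrArg (Int.cast : ℤ → F) (appellPoly_rec m (n + 1))
    rw [add_sub_cancel_right] at h
    rw [Finset.sum_range_succ, mul_add, ih]
    push_cast at h ⊢
    rw [pow_succ]
    linear_combination -(J ^ n * J) * h + J ^ n * ((appellPoly m).eval (n + 1 : ℤ) : ℤ) * hJ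

end eulerNumber

/-! ### An integral lift of `L_1` from the binomial expansion. -/

namespace polylogPoly

open Polynomial

section Lift

variable (p : ℕ)

/-- An integral polynomial reducing to `polylogPoly p 1` modulo `p`,
equal to `(1 - X ^ p - (1 - X) ^ p) / p`. -/
noncomputable def lift : ℤ[X] :=
  ∑ k ∈ Finset.Icc 1 (p - 1), C ((-1 : ℤ) ^ (k + 1) * (p.choose k / p : ℕ)) * X ^ k

variable [Fact p.Prime]

theorem one_sub_pow_prime {A : Type*} [CommRing A] (hp : Odd p) (x : A) :
    (1 - x) ^ p = 1 - x ^ p - p * aeval x (lift p) := by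
  have hpp := (Fact.out : p.Prime)
  have h1 : (1 - x) ^ p =
      ∑ m ∈ Finset.range (p - 1 + 1 + 1), (-x) ^ m * 1 ^ (p - m) * (p.choose m : A) := by
    rw [Nat.sub_add_cancel hpp.one_le, ← add_pow]
    ring
  rw [h1, Finset.sum_range_succ, Finset.sum_range_succ', Nat.sub_add_cancel hpp.one_le,
    Nat.choose_self, Nat.choose_zero_right, hp.neg_pow, lift, map_sum, Finset.mul_sum,
    Finset.sum_Icc_one_eq_sum_range]
  have h2 : ∀ k ∈ Finset.range (p - 1),
      (-x) ^ (k + 1) * 1 ^ (p - (k + 1)) * (p.choose (k + 1) : A) =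
      -((p : A) * aeval x (C ((-1 : ℤ) ^ (k + 1 + 1) * (p.choose (k + 1) / p : ℕ)) *
        X ^ (k + 1))) := by
    intro k hk
    rw [Finset.mem_range] at hk
    obtain ⟨c, hc⟩ := hpp.dvd_choose_self (by omega : k + 1 ≠ 0) (by omega)
    rw [hc, Nat.mul_div_cancel_left _ hpp.pos, neg_pow]
    simp only [map_mul, map_pow, aeval_X, map_neg, map_one, map_natCast, Nat.cast_mul]
    ring
  rw [Finset.sum_congr rfl h2, Finset.sum_neg_distrib]
  simp
  ring

theorem choose_pred {k : ℕ} (hk : k < p) : ((p - 1).choose k : ZMod p) = (-1) ^ k := by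
  have hpp := (Fact.out : p.Prime)
  induction k with
  | zero => simp
  | succ k ih =>
    have h := Nat.choose_succ_succ' (p - 1) k
    rw [Nat.sub_add_cancel hpp.one_le] at h
    have h2 : ((p.choose (k + 1) : ℕ) : ZMod p) = 0 :=
      (ZMod.natCast_eq_zero_iff _ _).2 (hpp.dvd_choose_self (by omega) hk)
    have h3 := congrArg (Nat.cast : ℕ → ZMod p) h
    push_cast at h3
    rw [pow_succ, ← ih (by omega)]
    linear_combination h2 - h3

/-- Here `binom(p,k)/p = binom(p-1,k-1)/k`, and `binom(p-1,k-1)` is `(-1)^(k-1)` modulo `p`. -/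
theorem map_lift : (lift p).map (Int.castRingHom (ZMod p)) = polylogPoly p 1 := by
  have hpp := (Fact.out : p.Prime)
  rw [lift, polylogPoly, Polynomial.map_sum]
  refine Finset.sum_congr rfl fun k hk => ?_
  have hk0 := cast_ne_zero_of_mem_Icc p hk
  rw [Finset.mem_Icc] at hk
  rw [Polynomial.map_mul, map_C, Polynomial.map_pow, map_X]
  congr 2
  obtain ⟨c, hc⟩ := hpp.dvd_choose_self (by omega : k ≠ 0) (by omega)
  obtain ⟨j, rfl⟩ : ∃ j, k = j + 1 := ⟨k - 1, by omega⟩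
  have h1 := Nat.add_one_mul_choose_eq (p - 1) j
  rw [Nat.sub_add_cancel hpp.one_le, hc, mul_assoc] at h1
  have h2 := congrArg (Nat.cast : ℕ → ZMod p) (Nat.eq_of_mul_eq_mul_left hpp.pos h1)
  rw [choose_pred p (by omega)] at h2
  rw [hc, Nat.mul_div_cancel_left _ hpp.pos, pow_one, ← mul_right_inj' hk0, mul_inv_cancel₀ hk0]
  push_cast at h2 ⊢
  simp only [map_mul, map_pow, map_neg, map_one, map_natCast]
  have h3 : ((-1 : ZMod p) ^ j) ^ 2 = 1 := by rw [← pow_mul, mul_comm, pow_mul]; simp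
  linear_combination (-(-1 : ZMod p) ^ j) * h2 + h3

end Lift

/-! ### Values at a square root of -1 and at related points. -/

section Char

variable {p : ℕ} [Fact p.Prime] {F : Type*} [CommRing F] [Algebra (ZMod p) F]

theorem aeval_lift (x : F) : aeval x (lift p) = aeval x (polylogPoly p 1) := by
  rw [← map_lift p, aeval_def, aeval_def, eval₂_map]
  congr 1
  exact RingHom.ext_int _ _

theorem aeval_eq_sum (d : ℕ) (x : F) : aeval x (polylogPoly p d) =
    ∑ k ∈ Finset.Icc 1 (p - 1), algebraMap (ZMod p) F ((k : ZMod p)⁻¹ ^ d) * x ^ k := by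
  rw [polylogPoly, map_sum]
  simp

theorem aeval_of_mul_eq_one {x y : F} (h : x * y = 1) (d : ℕ) :
    aeval x (polylogPoly p d) = (-1) ^ d * x ^ p * aeval y (polylogPoly p d) := by
  rw [aeval_eq_sum, aeval_eq_sum, Finset.mul_sum]
  refine Finset.sum_nbij' (p - ·) (p - ·) ?_ ?_ ?_ ?_ ?_
  · intro k hk
    simp only [Finset.mem_Icc] at hk ⊢
    omega
  · intro k hk
    simp only [Finset.mem_Icc] at hk ⊢
    omega
  · intro k hk
    simp only [Finset.mem_Icc] at hk ⊢
    omega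
  · intro k hk
    simp only [Finset.mem_Icc] at hk ⊢
    omega
  · intro k hk
    simp only [Finset.mem_Icc] at hk ⊢
    have h1 : (x : F) ^ p * y ^ (p - k) = x ^ k := by
      have : x ^ p = x ^ k * x ^ (p - k) := by rw [← pow_add]; congr 1; omega
      rw [this, mul_assoc, ← mul_pow, h, one_pow, mul_one]
    have h2 : ((p - k : ℕ) : ZMod p) = -k := by
      rw [Nat.cast_sub (by omega), CharP.cast_eq_zero, zero_sub]
    rw [h2, inv_neg, neg_pow (k : ZMod p)⁻¹ d, map_mul, map_pow _ (-1), map_neg, map_one,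
      ← h1]
    have h3 : ((-1 : F) ^ d) * (-1) ^ d = 1 := by rw [← mul_pow]; simp
    linear_combination
      -(algebraMap (ZMod p) F ((k : ZMod p)⁻¹ ^ d) * (x ^ p * y ^ (p - k))) * h3

theorem sq_aeval_one (hp : 3 < p) (x : F) : aeval x (polylogPoly p 1) ^ 2 =
    -2 * x ^ p * aeval x (polylogPoly p 2)
      - 2 * (1 - x ^ p) * aeval (1 - x) (polylogPoly p 2) := by
  have h := congrArg (aeval x) (sq_one p hp)
  simpa [aeval_comp, map_ofNat] using h

theorem pow_prime_of_sq_eq_neg_one {A : Type*} [CommRing A] {J : A} (hJ : J ^ 2 = -1)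
    (hp : Odd p) : J ^ p = (-1) ^ (p / 2) * J := by
  obtain ⟨n, rfl⟩ := hp
  rw [pow_succ, pow_mul, hJ]
  congr 2
  omega

theorem two_mul_aeval_two [CharP F p] (hp : 3 < p) {J : F} (hJ : J ^ 2 = -1) :
    2 * aeval J (polylogPoly p 2) = ((-1) ^ (p / 2) + J) * (eulerNumber.toInt (p - 3) : F) := by
  have hpp := (Fact.out : p.Prime)
  have hodd : Odd p := hpp.odd_of_ne_two (by omega)
  have h1 : aeval J (polylogPoly p 2) =
      ∑ k ∈ Finset.range (p - 1), J ^ (k + 1) * ((k + 1 : ℕ) : F) ^ (p - 3) := by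
    rw [aeval_eq_sum, ← Finset.sum_Icc_one_eq_sum_range (fun k => J ^ k * (k : F) ^ (p - 3))]
    refine Finset.sum_congr rfl fun k hk => ?_
    have hk0 := cast_ne_zero_of_mem_Icc p hk
    have h2 : (k : ZMod p)⁻¹ ^ 2 = (k : ZMod p) ^ (p - 3) := by
      rw [inv_pow, inv_eq_iff_eq_inv, ← one_div, eq_div_iff (pow_ne_zero _ hk0), ← pow_add,
        ← ZMod.pow_card_sub_one_eq_one hk0]
      congr 1
      omega
    rw [h2, map_pow, map_natCast, mul_comm]
  have hev : Even (p - 3) := by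
    obtain ⟨n, rfl⟩ := hodd
    exact ⟨n - 1, by omega⟩
  have hne : p - 3 ≠ 0 := by
    obtain ⟨n, rfl⟩ := hodd
    omega
  -- Integer coefficients allow the endpoints `p` and `p-1` to be replaced by `0` and `-1`.
  have hmod : ∀ a b : ℤ, (p : ℤ) ∣ a - b → (((eulerNumber.appellPoly (p - 3)).eval a : ℤ) : F) =
      ((eulerNumber.appellPoly (p - 3)).eval b : ℤ) := by
    intro a b hab
    rw [← sub_eq_zero, ← Int.cast_sub, CharP.intCast_eq_zero_iff F p]
    exact hab.trans (sub_dvd_eval_sub a b _)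
  have h3 := eulerNumber.two_mul_sum hJ (p - 3) (p - 1)
  have hc : ((p - 1 : ℕ) : ℤ) = p - 1 := by rw [Nat.cast_sub hpp.one_le, Nat.cast_one]
  have hpow : J * J ^ (p - 1) = (-1) ^ (p / 2) * J := by
    rw [← pow_succ', Nat.sub_add_cancel hpp.one_le, pow_prime_of_sq_eq_neg_one hJ hodd]
  rw [h1, h3, hc, sub_add_cancel, hmod p 0 (by simp),
    hmod (p - 1) (-1) (by simp), eulerNumber.appellPoly_one hev hne,
    eulerNumber.appellPoly_neg_one hev hne, eulerNumber.appellPoly_zero]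
  have hpow' : J ^ (p - 1) = (-1) ^ (p / 2) := by
    linear_combination (-J) * hpow + (J ^ (p - 1) - (-1) ^ (p / 2)) * hJ
  rw [hpow']
  push_cast
  ring

variable (F) in
theorem isUnit_two (hp : Odd p) : IsUnit (2 : F) := by
  have h : IsUnit ((2 : ℕ) : ZMod p) :=
    (ZMod.isUnit_iff_coprime 2 p).2 (Nat.coprime_two_left.2 hp)
  have h' := h.map (algebraMap (ZMod p) F)
  rwa [map_natCast, Nat.cast_ofNat] at h'

variable {S : Type*} [CommRing S] [IsDomain S] [CharZero S]

/-- The factor `p` must be cancelled before reduction, hence the characteristic-zero domain `S`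
above `F`. Reduction leaves one linear relation between `L_1(J)` and `L_1(-J)`; inversion, with `J *
(-J) = 1`, supplies the other. -/
theorem two_mul_aeval_one [CharP F p] (hp : 3 < p) (π : S →+* F) {J : S} (hJ : J ^ 2 = -1)
    {Q : ℤ} (hQ : 2 ^ (p - 1) - 1 = p * Q) :
    2 * aeval (π J) (polylogPoly p 1) = -(Q : F) * (1 - (-1) ^ (p / 2) * π J) := by
  have hpp := (Fact.out : p.Prime)
  have hodd : Odd p := hpp.odd_of_ne_two (by omega)
  have hJp := pow_prime_of_sq_eq_neg_one hJ hodd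
  have h1 := one_sub_pow_prime p hodd J
  have h2 := one_sub_pow_prime p hodd (-J)
  have hε : ((-1 : S) ^ (p / 2)) ^ 2 = 1 := by rw [← pow_mul, mul_comm, pow_mul]; simp
  have hε' : ((-1 : F) ^ (p / 2)) ^ 2 = 1 := by rw [← pow_mul, mul_comm, pow_mul]; simp
  rw [hodd.neg_pow] at h2
  have h3 : (1 - J) ^ p * (1 - -J) ^ p = 2 + 2 * (p * (Q : S)) := by
    have h4 : (1 - J) * (1 - -J) = 2 := by linear_combination -hJ
    have h5 := congrArg (Int.cast : ℤ → S) hQ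
    push_cast at h5
    rw [← mul_pow, h4, ← h5]
    obtain ⟨n, hn⟩ : ∃ n, p = n + 1 := ⟨p - 1, by omega⟩
    rw [hn, Nat.add_sub_cancel]
    ring
  rw [h1, h2, hJp] at h3
  have hp0 : (p : S) ≠ 0 := Nat.cast_ne_zero.2 hpp.ne_zero
  have h6 : 2 * (Q : S) = -((1 - (-1) ^ (p / 2) * J) * aeval (-J) (lift p)
      + (1 + (-1) ^ (p / 2) * J) * aeval J (lift p)) + p * (aeval J (lift p) * aeval (-J) (lift p)) := by
    refine mul_left_cancel₀ hp0 ?_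
    linear_combination -h3 - J ^ 2 * hε - hJ
  have hπ : ∀ x : S, π (aeval x (lift p)) = aeval (π x) (polylogPoly p 1) := by
    intro x
    rw [← aeval_lift]
    exact (aeval_algHom_apply π.toIntAlgHom x _).symm
  have h7 := congrArg π h6
  simp only [map_mul, map_add, map_neg, map_sub, map_pow, map_one, hπ, map_natCast, map_intCast,
    map_ofNat, CharP.cast_eq_zero, zero_mul, add_zero] at h7
  have hJF : π J ^ 2 = -1 := by rw [← map_pow, hJ, map_neg, map_one]
  have hinv := aeval_of_mul_eq_one (p := p) (show π J * (-π J) = 1 by linear_combination -hJF) 1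
  rw [pow_prime_of_sq_eq_neg_one hJF hodd] at hinv
  set ε : F := (-1) ^ (p / 2)
  set j := π J
  set a := aeval j (polylogPoly p 1)
  set b := aeval (-j) (polylogPoly p 1)
  have hu := isUnit_two F hodd
  have hb : b = ε * j * a := by
    linear_combination -(ε * j) * hinv + b * j ^ 2 * hε' + b * hJF
  rw [hb] at h7
  refine hu.mul_left_cancel ?_
  linear_combination (1 - ε * j) * h7 + a * (3 - ε * j) * (j ^ 2 * hε' + hJF)

theorem eight_mul_aeval_one_sub [CharP F p] (hp : 3 < p) (π : S →+* F) {J : S} (hJ : J ^ 2 = -1)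
    {Q : ℤ} (hQ : 2 ^ (p - 1) - 1 = p * Q) :
    8 * aeval (1 - π J) (polylogPoly p 2) = -(Q : F) ^ 2 * (1 - (-1) ^ (p / 2) * π J)
      + 4 * (-1) ^ (p / 2) * (eulerNumber.toInt (p - 3) : F) := by
  have hpp := (Fact.out : p.Prime)
  have hodd : Odd p := hpp.odd_of_ne_two (by omega)
  have hε : ((-1 : F) ^ (p / 2)) ^ 2 = 1 := by rw [← pow_mul, mul_comm, pow_mul]; simp
  have hJF : π J ^ 2 = -1 := by rw [← map_pow, hJ, map_neg, map_one]
  have h1 := two_mul_aeval_one hp π hJ hQ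
  have h2 := two_mul_aeval_two hp hJF
  have h3 := sq_aeval_one hp (π J)
  rw [pow_prime_of_sq_eq_neg_one hJF hodd] at h3
  have hu := isUnit_two F hodd
  set ε : F := (-1) ^ (p / 2)
  set j := π J
  set a := aeval j (polylogPoly p 1)
  set b := aeval (1 - j) (polylogPoly p 2)
  set E : F := (eulerNumber.toInt (p - 3) : F)
  refine hu.mul_left_cancel ?_
  -- The factor `1 + εj` turns the coefficient `1 - εj` of `b` into 2.
  linear_combination 4 * (1 + ε * j) * h3 + (8 * b + (1 - ε * j) * (Q : F) ^ 2) *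
    (j ^ 2 * hε + hJF) - (1 + ε * j) * (2 * a - Q * (1 - ε * j)) * h1
    - 4 * (ε * j) * (1 + ε * j) * h2
    - 4 * E * ((1 + ε * j) * (j * hε + ε * hJF) + ε * hJF - j * hε)

theorem eight_mul_aeval_inv_one_sub [CharP F p] (hp : 3 < p) (π : S →+* F) {J : S}
    (hJ : J ^ 2 = -1) {Q : ℤ} (hQ : 2 ^ (p - 1) - 1 = p * Q) {y : F} (hy : 2 * y = 1 + π J) :
    8 * aeval y (polylogPoly p 2) = -(Q : F) ^ 2
      + 2 * ((-1) ^ (p / 2) + π J) * (eulerNumber.toInt (p - 3) : F) := by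
  have hpp := (Fact.out : p.Prime)
  have hodd : Odd p := hpp.odd_of_ne_two (by omega)
  have hε : ((-1 : F) ^ (p / 2)) ^ 2 = 1 := by rw [← pow_mul, mul_comm, pow_mul]; simp
  have hJF : π J ^ 2 = -1 := by rw [← map_pow, hJ, map_neg, map_one]
  have hu := isUnit_two F hodd
  have hy1 : y * (1 - π J) = 1 := by
    refine hu.mul_left_cancel ?_
    linear_combination (1 - π J) * hy - hJF
  have h1 := eight_mul_aeval_one_sub hp π hJ hQ
  have h2 := aeval_of_mul_eq_one (p := p) hy1 2
  have h3 : 2 * y ^ p = 1 + (-1) ^ (p / 2) * π J := by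
    have h4 := congrArg (· ^ p) hy
    have h5 : (2 : F) ^ p = 2 := by
      have := congrArg (algebraMap (ZMod p) F) (ZMod.pow_card (2 : ZMod p))
      rwa [map_pow, map_ofNat] at this
    simp only [mul_pow, h5] at h4
    rw [h4, add_pow_char, one_pow, pow_prime_of_sq_eq_neg_one hJF hodd]
  refine hu.mul_left_cancel ?_
  rw [h2]
  linear_combination (2 * y ^ p) * h1 + (-(Q : F) ^ 2 * (1 - (-1) ^ (p / 2) * π J)
      + 4 * (-1) ^ (p / 2) * (eulerNumber.toInt (p - 3) : F)) * h3
    + (Q : F) ^ 2 * (π J ^ 2 * hε + hJF) + 4 * π J * (eulerNumber.toInt (p - 3) : F) * hε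

end Char

end polylogPoly

/-! ### Localized Gaussian integers and reduction modulo `p`. -/

/-- The subring of `ℂ` of the fractions `z / m` with `z` a Gaussian integer and `m` an integer not
divisible by `p`. -/
noncomputable def gaussianLocal (p : ℕ) [Fact p.Prime] : Subring ℂ where
  carrier := {x | ∃ (m : ℤ) (z : GaussianInt), ¬ (p : ℤ) ∣ m ∧ x = (z : ℂ) / (m : ℂ)}
  one_mem' := ⟨1, 1, by
    rw [← Nat.cast_one, Int.natCast_dvd_natCast]
    exact (Fact.out : p.Prime).one_lt.not_ge ∘ Nat.le_of_dvd one_pos, by simp⟩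
  zero_mem' := ⟨1, 0, by
    rw [← Nat.cast_one, Int.natCast_dvd_natCast]
    exact (Fact.out : p.Prime).one_lt.not_ge ∘ Nat.le_of_dvd one_pos, by simp⟩
  mul_mem' := by
    rintro _ _ ⟨m, z, hm, rfl⟩ ⟨n, w, hn, rfl⟩
    refine ⟨m * n, z * w, ?_, ?_⟩
    · rw [(Nat.prime_iff_prime_int.1 Fact.out).dvd_mul]
      tauto
    · push_cast
      rw [GaussianInt.toComplex_mul, div_mul_div_comm]
  neg_mem' := by
    rintro _ ⟨m, z, hm, rfl⟩
    exact ⟨m, -z, hm, by rw [GaussianInt.toComplex_neg, neg_div]⟩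
  add_mem' := by
    rintro _ _ ⟨m, z, hm, rfl⟩ ⟨n, w, hn, rfl⟩
    refine ⟨m * n, z * n + m * w, ?_, ?_⟩
    · rw [(Nat.prime_iff_prime_int.1 Fact.out).dvd_mul]
      tauto
    · have hm0 : (m : ℂ) ≠ 0 := by
        rintro h
        exact hm (by simp [Int.cast_eq_zero.1 h])
      have hn0 : (n : ℂ) ≠ 0 := by
        rintro h
        exact hn (by simp [Int.cast_eq_zero.1 h])
      rw [div_add_div _ _ hm0 hn0]
      simp

namespace gaussianLocal

variable {p : ℕ} [Fact p.Prime]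

theorem I_mem : Complex.I ∈ gaussianLocal p :=
  ⟨1, ⟨0, 1⟩, by
    rw [← Nat.cast_one, Int.natCast_dvd_natCast]
    exact (Fact.out : p.Prime).one_lt.not_ge ∘ Nat.le_of_dvd one_pos, by
    simp [GaussianInt.toComplex_def]⟩

theorem inv_natCast_mem {k : ℕ} (hk : ¬ p ∣ k) : ((k : ℂ))⁻¹ ∈ gaussianLocal p :=
  ⟨k, 1, by rwa [Int.natCast_dvd_natCast], by simp⟩

variable (p) in
/-- The residue ring of `gaussianLocal p` modulo `p`. -/
abbrev Residue : Type := gaussianLocal p ⧸ Ideal.span {(p : gaussianLocal p)}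

variable (p) in
/-- Reduction modulo `p`. -/
noncomputable abbrev residue : gaussianLocal p →+* Residue p := Ideal.Quotient.mk _

/-- Scaling by `N` prime to `p` clears the denominators 2, 4 and 8 of the target formulas; it is
used with `N = 8`. -/
theorem gaussianCongr_of_residue_eq {N : ℕ} (hN : ¬ p ∣ N) {x y : ℂ} {s t : gaussianLocal p}
    (hx : (s : ℂ) = N * x) (hy : (t : ℂ) = N * y) (h : residue p s = residue p t) :
    GaussianCongr p x y := by
  rw [Ideal.Quotient.eq, Ideal.mem_span_singleton] at h
  obtain ⟨⟨_, m, z, hm, rfl⟩, hc⟩ := h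
  have hc' := congrArg (Subtype.val : gaussianLocal p → ℂ) hc
  push_cast at hc'
  rw [hx, hy] at hc'
  have hN0 : (N : ℂ) ≠ 0 := by
    intro h0
    exact hN (by simp [Nat.cast_eq_zero.1 h0])
  refine ⟨N * m, z, ?_, ?_⟩
  · rw [(Nat.prime_iff_prime_int.1 Fact.out).dvd_mul, Int.natCast_dvd_natCast]
    tauto
  · have : x - y = (p * ((z : ℂ) / m)) / N := by
      rw [eq_div_iff hN0]
      linear_combination hc'
    rw [this, mul_div_assoc, div_div]
    push_cast
    rw [mul_comm (m : ℂ)]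

instance : Nontrivial (Residue p) := by
  refine Ideal.Quotient.nontrivial_iff.2 ?_
  rw [Ne, Ideal.span_singleton_eq_top]
  rintro h
  obtain ⟨⟨_, m, z, hm, rfl⟩, hc⟩ := h.exists_right_inv
  have hc' := congrArg (Subtype.val : gaussianLocal p → ℂ) hc
  push_cast at hc'
  have hm0 : (m : ℂ) ≠ 0 := by
    rintro h
    exact hm (by simp [Int.cast_eq_zero.1 h])
  rw [← mul_div_assoc, div_eq_iff hm0, one_mul] at hc'
  -- If `p` were a unit, real parts would give `m = p * z.re`, against `¬ p ∣ m`.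
  have hre := congrArg Complex.re hc'
  rw [← Complex.ofReal_natCast, Complex.re_ofReal_mul, ← GaussianInt.intCast_re,
    Complex.intCast_re] at hre
  exact hm ⟨z.re, by exact_mod_cast hre.symm⟩

instance : CharP (Residue p) p :=
  (CharP.charP_iff_prime_eq_zero Fact.out).2 (by
    have : residue p (p : gaussianLocal p) = 0 :=
      Ideal.Quotient.eq_zero_iff_mem.2 (Ideal.mem_span_singleton_self _)
    rwa [map_natCast] at this)

noncomputable instance : Algebra (ZMod p) (Residue p) := ZMod.algebra _ p

end gaussianLocal

/-! ### Transfer of the residue identities to complex congruences. -/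

namespace gaussianLocal

open Polynomial

variable {p : ℕ} [Fact p.Prime]

@[simp, norm_cast]
theorem coe_ofNat (n : ℕ) [n.AtLeastTwo] :
    ((ofNat(n) : gaussianLocal p) : ℂ) = ofNat(n) :=
  map_ofNat (gaussianLocal p).subtype n

theorem exists_coe_eq_finitePolylog (d : ℕ) (x : gaussianLocal p) :
    ∃ s : gaussianLocal p, (s : ℂ) = finitePolylog p d (x : ℂ) ∧
      residue p s = aeval (residue p x) (polylogPoly p d) := by
  have h : ∀ k ∈ Finset.Icc 1 (p - 1), ∃ u : gaussianLocal p, (u : ℂ) = (k : ℂ)⁻¹ ∧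
      residue p u = algebraMap (ZMod p) _ (k : ZMod p)⁻¹ := by
    intro k hk
    have hk0 := polylogPoly.cast_ne_zero_of_mem_Icc p hk
    have hkp : ¬ p ∣ k := by rwa [← ZMod.natCast_eq_zero_iff]
    have hkC : (k : ℂ) ≠ 0 := by
      intro h0
      exact hkp (by simp [Nat.cast_eq_zero.1 h0])
    refine ⟨⟨_, inv_natCast_mem hkp⟩, rfl, ?_⟩
    have h1 : (⟨_, inv_natCast_mem hkp⟩ : gaussianLocal p) * (k : gaussianLocal p) = 1 :=
      Subtype.ext (by push_cast; exact inv_mul_cancel₀ hkC)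
    have h2 := congrArg (residue p) h1
    have h3 := congrArg (algebraMap (ZMod p) (Residue p)) (mul_inv_cancel₀ hk0)
    rw [map_mul, map_natCast, map_one] at h2 h3
    exact left_inv_eq_right_inv h2 h3
  choose! u hu hr using h
  refine ⟨∑ k ∈ Finset.Icc 1 (p - 1), u k ^ d * x ^ k, ?_, ?_⟩
  · push_cast
    rw [finitePolylog]
    refine Finset.sum_congr rfl fun k hk => ?_
    rw [hu k hk, inv_pow, mul_comm, div_eq_mul_inv]
  · rw [polylogPoly.aeval_eq_sum, map_sum]
    refine Finset.sum_congr rfl fun k hk => ?_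
    rw [map_mul, map_pow, map_pow, hr k hk, map_pow]

theorem polylog_congr (hp : 3 < p) {c : ℂ} (hc : c ^ 2 = -1) (hmem : c ∈ gaussianLocal p) :
    GaussianCongr p (finitePolylog p 2 (1 - c))
      (-((fermatQuotient p (2 : ℂ)) ^ 2 / 8) * (1 - c * (legendreSym p (-1) : ℂ))
        + 1 / 2 * (legendreSym p (-1) : ℂ) * (eulerNumber (p - 3) : ℂ)) ∧
    GaussianCongr p (finitePolylog p 2 ((1 + c) / 2))
      (-((fermatQuotient p (2 : ℂ)) ^ 2 / 8)
        + 1 / 4 * ((legendreSym p (-1) : ℂ) + c) * (eulerNumber (p - 3) : ℂ)) := by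
  have hpp := (Fact.out : p.Prime)
  have hodd : Odd p := hpp.odd_of_ne_two (by omega)
  have hcop : p.Coprime 2 := Nat.coprime_two_right.2 hodd
  have h8 : ¬ p ∣ 8 := by
    intro h
    exact hpp.one_lt.ne' (Nat.Coprime.eq_one_of_dvd (hcop.pow_right 3) h)
  have h2 : ¬ p ∣ 2 := fun h => h8 (h.trans (by norm_num))
  obtain ⟨Q, hQ⟩ : (p : ℤ) ∣ 2 ^ (p - 1) - 1 := by
    have := Int.ModEq.pow_card_sub_one_eq_one hpp (n := 2)
      (by exact_mod_cast (Nat.isCoprime_iff_coprime.2 hcop).symm)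
    exact this.symm.dvd
  have hq : fermatQuotient p (2 : ℂ) = Q := by
    have h := congrArg (Int.cast : ℤ → ℂ) hQ
    push_cast at h
    rw [fermatQuotient, h, mul_div_cancel_left₀ _ (Nat.cast_ne_zero.2 hpp.ne_zero)]
  have hL : (legendreSym p (-1) : ℂ) = (-1) ^ (p / 2) := by
    rw [legendreSym.at_neg_one (by omega), ZMod.χ₄_eq_neg_one_pow (Nat.odd_iff.1 hodd)]
    push_cast
    rfl
  have hE : (eulerNumber (p - 3) : ℂ) = eulerNumber.toInt (p - 3) := by
    rw [eulerNumber.toInt_spec]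
    push_cast
    rfl
  rw [hq, hL, hE]
  let J : gaussianLocal p := ⟨c, hmem⟩
  let y : gaussianLocal p := ⟨2⁻¹, inv_natCast_mem h2⟩ * (1 + J)
  have hJ : J ^ 2 = -1 := Subtype.ext (by simpa [J] using hc)
  have hy : 2 * y = 1 + J := Subtype.ext (by simp [y])
  constructor
  · obtain ⟨s, hs, hr⟩ := exists_coe_eq_finitePolylog 2 (1 - J)
    refine gaussianCongr_of_residue_eq h8 (s := 8 * s)
      (t := -(Q : gaussianLocal p) ^ 2 * (1 - (-1) ^ (p / 2) * J)
        + 4 * (-1) ^ (p / 2) * (eulerNumber.toInt (p - 3) : gaussianLocal p)) ?_ ?_ ?_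
    · push_cast
      rw [hs]
      rfl
    · push_cast
      simp only [J]
      ring
    · have := polylogPoly.eight_mul_aeval_one_sub hp (residue p) hJ hQ
      rw [map_sub, map_one] at hr
      rw [← hr] at this
      simpa only [map_mul, map_add, map_neg, map_sub, map_pow, map_one, map_natCast, map_intCast,
        map_ofNat] using this
  · obtain ⟨s, hs, hr⟩ := exists_coe_eq_finitePolylog 2 y
    refine gaussianCongr_of_residue_eq h8 (s := 8 * s)
      (t := -(Q : gaussianLocal p) ^ 2
        + 2 * ((-1) ^ (p / 2) + J) * (eulerNumber.toInt (p - 3) : gaussianLocal p)) ?_ ?_ ?_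
    · push_cast
      rw [hs]
      simp only [y, J]
      push_cast
      rw [inv_mul_eq_div]
    · push_cast
      simp only [J]
      ring
    · have hy' := congrArg (residue p) hy
      rw [map_mul, map_add, map_one, map_ofNat] at hy'
      have := polylogPoly.eight_mul_aeval_inv_one_sub hp (residue p) hJ hQ hy'
      rw [← hr] at this
      simpa only [map_mul, map_add, map_neg, map_sub, map_pow, map_one, map_natCast, map_intCast,
        map_ofNat] using this

end gaussianLocal

theorem mainTheorem5 (p : ℕ) [Fact p.Prime] (hp : 3 < p) :
    GaussianCongr p (finitePolylog p 2 (1 + Complex.I))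
      (-((fermatQuotient p (2 : ℂ)) ^ 2 / 8) * (1 + Complex.I * (legendreSym p (-1) : ℂ))
        + 1 / 2 * (legendreSym p (-1) : ℂ) * (eulerNumber (p - 3) : ℂ)) ∧
    GaussianCongr p (finitePolylog p 2 (1 - Complex.I))
      (-((fermatQuotient p (2 : ℂ)) ^ 2 / 8) * (1 - Complex.I * (legendreSym p (-1) : ℂ))
        + 1 / 2 * (legendreSym p (-1) : ℂ) * (eulerNumber (p - 3) : ℂ)) ∧
    GaussianCongr p (finitePolylog p 2 ((1 + Complex.I) / 2))
      (-((fermatQuotient p (2 : ℂ)) ^ 2 / 8)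
        + 1 / 4 * ((legendreSym p (-1) : ℂ) + Complex.I) * (eulerNumber (p - 3) : ℂ)) ∧
    GaussianCongr p (finitePolylog p 2 ((1 - Complex.I) / 2))
      (-((fermatQuotient p (2 : ℂ)) ^ 2 / 8)
        + 1 / 4 * ((legendreSym p (-1) : ℂ) - Complex.I) * (eulerNumber (p - 3) : ℂ)) := by
  -- The point `1 - c` carries the opposite sign, so the formula at `1 + i` comes from `c = -i`.
  have h1 := gaussianLocal.polylog_congr hp Complex.I_sq gaussianLocal.I_mem
  have h2 := gaussianLocal.polylog_congr hp (c := -Complex.I) (by simp)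
    (neg_mem gaussianLocal.I_mem)
  simp only [sub_neg_eq_add, neg_mul, ← sub_eq_add_neg] at h1 h2 ⊢
  exact ⟨h2.1, h1.1, h1.2, h2.2⟩
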